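/- For $n\ge 2$ let $\{e_{i,j} : 0\le i\le 2,\ 0\le j\le n-1\}$ be the canonical basis of $\mathbb{R}^{3\times n}$, and for $0\le i\le 1$, $0\le j\le n-2$ let $\Delta_{i,j}=\operatorname{conv}\{e_{i,j},\,e_{i,j+1},\,e_{i+1,j},\,e_{i+1,j+1}\}$. Let $$Q_n=\sum_{0\le i\le 1,\ 0\le j\le n-2}\Delta_{i,j}$$ be the Minkowski sum of these $2(n-1)$ simplices, and let $V_n$ be the number of vertices of the polytope $Q_n$. Then, as formal power series, $$x+\sum_{n\ge 2}V_n x^n=\frac{x+x^2-x^3}{1-13x+31x^2-20x^3+4x^4}.$$ Equivalently, $V_n$ is given by the recurrence relation $$V_{n+4}=13V_{n+3}-31V_{n+2}+20V_{n+1}-4V_n\qquad\text{for all } n\ge 2,$$ with initial values $V_2=14$, $V_3=150$, $V_4=1536$ and $V_5=15594$. -/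

import Mathlib

open scoped Pointwise

namespace MaxPool

noncomputable section

/-- The canonical basis vector `e_{i,j}` of `ℝ^{3 × n}`, for `0 ≤ i ≤ 2` and `0 ≤ j ≤ n - 1`.
(Natural-number indices keep the windows readable; only indices in this range are used below.) -/
def e (n i j : ℕ) : Fin 3 × Fin n → ℝ :=
  fun p => if (p.1 : ℕ) = i ∧ (p.2 : ℕ) = j then 1 else 0

/-- The simplex `Δ_{i,j}` of the `2 × 2` window with upper left corner `(i, j)`. -/
def simplex (n i j : ℕ) : Set (Fin 3 × Fin n → ℝ) :=
  convexHull ℝ {e n i j, e n i (j + 1), e n (i + 1) j, e n (i + 1) (j + 1)}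

/-- The polytope `Q_n`: the Minkowski sum (pointwise sum of sets) of the `2 (n - 1)` simplices
`Δ_{i,j}` with `0 ≤ i ≤ 1` and `0 ≤ j ≤ n - 2`. Meant for `2 ≤ n`. -/
def Q (n : ℕ) : Set (Fin 3 × Fin n → ℝ) :=
  ∑ i ∈ Finset.range 2, ∑ j ∈ Finset.range (n - 1), simplex n i j

/-- The number `V_n` of vertices (extreme points) of `Q_n`. -/
def V (n : ℕ) : ℕ :=
  (Set.extremePoints ℝ (Q n)).ncard

end

end MaxPool

namespace MaxPool

/-! A vertex of a Minkowski sum of simplices is a choice of one vertex per summand such that some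
linear functional is strictly maximal at all of them simultaneously. For `Q n` a functional is a
height for each cell, so `V n` counts the patterns of window maxima that heights can realise
(`V_eq_count`). These patterns are counted by a transfer matrix. Reading columns left to right, all
that the past imposes on the current column is a set of strict inequalities between its three
heights, obtained by Fourier–Motzkin elimination (`satOn_step_iff`). Only twelve such systems occur
(`step_state`), and linear relations between their counts (`count_state_relations`) leave a 4 × 4
system, whose characteristic polynomial is the recurrence. -/

/-! ### Vertices of Minkowski sums -/

theorem ncard_extremePoints_convexHull_range_sum {ι κ E : Type*} [Fintype ι] [Finite κ]
    [AddCommGroup E] [Module ℝ E] [TopologicalSpace E] [IsTopologicalAddGroup E]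
    [ContinuousSMul ℝ E] [T2Space E] [LocallyConvexSpace ℝ E] (p : ι → κ → E)
    (hp : ∀ i, Function.Injective (p i)) :
    (Set.extremePoints ℝ (convexHull ℝ (Set.range fun σ : ι → κ => ∑ i, p i (σ i)))).ncard =
      {σ : ι → κ | ∃ l : E →L[ℝ] ℝ, ∀ i k, k ≠ σ i → l (p i k) < l (p i (σ i))}.ncard := by
  classical
  set vtx : (ι → κ) → E := fun σ => ∑ i, p i (σ i) with hvtx
  set A := convexHull ℝ (Set.range vtx) with hA
  have hlt : ∀ (σ τ : ι → κ) (l : E →L[ℝ] ℝ), (∀ i k, k ≠ σ i → l (p i k) < l (p i (σ i))) →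
      τ ≠ σ → l (vtx τ) < l (vtx σ) := by
    intro σ τ l h hne
    obtain ⟨i, hi⟩ := Function.ne_iff.1 hne
    simp only [hvtx, map_sum]
    refine Finset.sum_lt_sum (fun j _ => ?_) ⟨i, Finset.mem_univ i, h i _ hi⟩
    by_cases hj : τ j = σ j
    · rw [hj]
    · exact (h j _ hj).le
  have himage : Set.extremePoints ℝ A = vtx ''
      {σ : ι → κ | ∃ l : E →L[ℝ] ℝ, ∀ i k, k ≠ σ i → l (p i k) < l (p i (σ i))} := by
    ext x
    constructor
    · intro hx
      obtain ⟨σ, rfl⟩ := extremePoints_convexHull_subset hx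
      refine ⟨σ, ?_, rfl⟩
      rw [(convex_convexHull ℝ _).mem_extremePoints_iff_mem_sdiff_convexHull_sdiff] at hx
      have hx' : vtx σ ∉ convexHull ℝ (Set.range vtx \ {vtx σ}) := fun h =>
        hx.2 (convexHull_mono (Set.sdiff_subset_sdiff_left (subset_convexHull ℝ _)) h)
      have hfin : (Set.range vtx \ {vtx σ}).Finite := Set.toFinite _
      obtain ⟨l, u, hl, hu⟩ := geometric_hahn_banach_closed_point (convex_convexHull ℝ _)
        (hfin.isClosed_convexHull ℝ) hx'
      refine ⟨l, fun i k hk => ?_⟩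
      -- Separation from the sum with one summand changed gives the inequality for that summand
      -- alone.
      have hupd : vtx (Function.update σ i k) + p i (σ i) = vtx σ + p i k := by
        simp only [hvtx]
        rw [← Finset.add_sum_erase _ _ (Finset.mem_univ i),
          ← Finset.add_sum_erase (a := i) _ (fun j => p j (σ j)) (Finset.mem_univ i),
          Finset.sum_congr rfl (fun j hj => by
            rw [Function.update_of_ne (Finset.ne_of_mem_erase hj)]), Function.update_self]
        abel
      have hne : vtx (Function.update σ i k) ≠ vtx σ := by
        intro h
        rw [h] at hupd
        exact hk (hp i (add_left_cancel hupd)).symm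
      have h1 := (hl _ (subset_convexHull ℝ _ ⟨⟨_, rfl⟩, hne⟩)).trans hu
      have h2 := congrArg l hupd
      simp only [map_add] at h2
      linarith
    · rintro ⟨σ, ⟨l, h⟩, rfl⟩
      rw [(convex_convexHull ℝ _).mem_extremePoints_iff_mem_sdiff_convexHull_sdiff]
      refine ⟨subset_convexHull ℝ _ ⟨σ, rfl⟩, ?_⟩
      -- An open half-space with one boundary point added is still convex.
      have hconv : Convex ℝ {y | y = vtx σ ∨ l y < l (vtx σ)} := by
        rw [convex_iff_forall_pos]
        rintro y hy z hz a b ha hb hab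
        have hle : ∀ w, w = vtx σ ∨ l w < l (vtx σ) → l w ≤ l (vtx σ) := by
          rintro w (rfl | hw)
          exacts [le_rfl, hw.le]
        have hb' : b = 1 - a := by linarith
        rcases hy with rfl | hy
        · rcases hz with rfl | hz
          · exact Or.inl (by rw [← add_smul, hab, one_smul])
          · refine Or.inr ?_
            simp only [map_add, map_smul, smul_eq_mul]
            subst hb'
            nlinarith
        · refine Or.inr ?_
          have := hle z hz
          simp only [map_add, map_smul, smul_eq_mul]
          subst hb'
          nlinarith
      have hsub : A ⊆ {y | y = vtx σ ∨ l y < l (vtx σ)} := by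
        refine convexHull_min ?_ hconv
        rintro _ ⟨τ, rfl⟩
        by_cases hτ : τ = σ
        · exact Or.inl (by rw [hτ])
        · exact Or.inr (hlt σ τ l h hτ)
      have hsub' : convexHull ℝ (A \ {vtx σ}) ⊆ {y | l y < l (vtx σ)} :=
        convexHull_min (fun y hy => (hsub hy.1).resolve_left hy.2)
          (convex_halfSpace_lt l.toLinearMap.isLinear _)
      exact fun hmem => lt_irrefl (l (vtx σ)) (hsub' hmem)
  rw [himage]
  refine Set.InjOn.ncard_image ?_
  rintro σ ⟨l, h⟩ τ - heq
  by_contra hne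
  have := hlt σ τ l h (Ne.symm hne)
  rw [heq] at this
  exact lt_irrefl _ this

/-! ### Fourier–Motzkin elimination -/

/-- The assignment `f` satisfies the strict inequalities `f a < f b` for `R a b`, `a b ∈ S`. -/
def SatOn {α : Type*} (S : Set α) (R : α → α → Bool) (f : α → ℝ) : Prop :=
  ∀ a ∈ S, ∀ b ∈ S, R a b = true → f a < f b

/-- One step of Fourier–Motzkin elimination: add the consequences of `R` passing through `v`;
a loop at `v` makes the system unsatisfiable. -/
def elim {α : Type*} (v : α) (R : α → α → Bool) (a b : α) : Bool :=
  R a b || (R a v && R v b) || R v v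

theorem satOn_elim_iff {α : Type*} {S : Set α} {R : α → α → Bool} {f : α → ℝ} {v : α}
    (hv : v ∈ S) : SatOn S (elim v R) f ↔ SatOn S R f := by
  constructor
  · intro h a ha b hb hab
    exact h a ha b hb (by simp [elim, hab])
  · intro h a ha b hb hab
    simp only [elim, Bool.or_eq_true, Bool.and_eq_true] at hab
    rcases hab with (hab | ⟨h1, h2⟩) | hvv
    · exact h a ha b hb hab
    · exact (h a ha v hv h1).trans (h v hv b hb h2)
    · exact absurd (h v hv v hv hvv) (lt_irrefl _)

/-- A value at `v` must lie above finitely many reals and below finitely many others, which is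
possible once each lower bound is less than each upper one. `T` is nonempty so that a loop at `v`
still leaves a contradiction in `T`. -/
theorem exists_satOn_insert_iff {α : Type*} [Finite α] {T U : Set α} {R : α → α → Bool}
    {f : α → ℝ} {v : α} (hvT : v ∉ T) (hUT : U ⊆ T) (hT : T.Nonempty) :
    (∃ g, Set.EqOn g f U ∧ SatOn (insert v T) R g) ↔
      ∃ g, Set.EqOn g f U ∧ SatOn T (elim v R) g := by
  classical
  constructor
  · rintro ⟨g, hg, h⟩
    refine ⟨g, hg, fun a ha b hb hab => ?_⟩
    exact (satOn_elim_iff (Set.mem_insert v T)).2 h a (Or.inr ha) b (Or.inr hb) hab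
  · rintro ⟨g, hg, h⟩
    obtain ⟨t, ht⟩ := hT
    have hvv : R v v = false := by
      by_contra hvv
      exact lt_irrefl _ (h t ht t ht (by simp [elim, hvv]))
    have fin1 : (g '' {a | a ∈ T ∧ R a v = true}).Finite := Set.toFinite _
    have fin2 : (g '' {a | a ∈ T ∧ R v a = true}).Finite := Set.toFinite _
    obtain ⟨x, hx1, hx2⟩ := Order.exists_between_finsets (lo := fin1.toFinset)
      (hi := fin2.toFinset) (by
        simp only [Set.Finite.mem_toFinset]
        rintro _ ⟨a, ⟨ha, hav⟩, rfl⟩ _ ⟨b, ⟨hb, hvb⟩, rfl⟩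
        exact h a ha b hb (by simp [elim, hav, hvb]))
    simp only [Set.Finite.mem_toFinset] at hx1 hx2
    have hne : ∀ a ∈ T, Function.update g v x a = g a := fun a ha =>
      Function.update_of_ne (ne_of_mem_of_not_mem ha hvT) _ _
    refine ⟨Function.update g v x, fun a ha => (hne a (hUT ha)).trans (hg ha), ?_⟩
    rintro a (rfl | ha) b (rfl | hb) hab
    · simp [hvv] at hab
    · rw [hne b hb, Function.update_self]
      exact hx2 _ ⟨b, ⟨hb, hab⟩, rfl⟩
    · rw [hne a ha, Function.update_self]
      exact hx1 _ ⟨a, ⟨ha, hab⟩, rfl⟩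
    · rw [hne a ha, hne b hb]
      exact h a ha b hb (by simp [elim, hab])

/-! ### Passing from one column to the next -/

/-- The four cells `(column, row)` of the upper (`w = 0`) and lower (`w = 1`) window on two
adjacent columns. -/
def cell : Fin 2 → Fin 4 → Fin 2 × Fin 3 :=
  ![![(0, 0), (0, 1), (1, 0), (1, 1)], ![(0, 1), (0, 2), (1, 1), (1, 2)]]

/-- The inequalities saying that in each of the two windows the cell chosen by `t` is maximal. -/
def windowRel (t : Fin 4 × Fin 4) (a b : Fin 2 × Fin 3) : Bool :=
  decide (∃ w q, q ≠ ![t.1, t.2] w ∧ cell w q = a ∧ cell w (![t.1, t.2] w) = b)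

/-- The inequalities `P` on the left column together with those of the two windows. -/
def glueRel (P : Fin 3 → Fin 3 → Bool) (t : Fin 4 × Fin 4) (a b : Fin 2 × Fin 3) : Bool :=
  (a.1 == 0 && b.1 == 0 && P a.2 b.2) || windowRel t a b

/-- The inequalities induced on the right column by `glueRel P t`. -/
def step (P : Fin 3 → Fin 3 → Bool) (t : Fin 4 × Fin 4) (a b : Fin 3) : Bool :=
  elim (1, 2) (elim (1, 1) (elim (1, 0) (elim (0, 2) (elim (0, 1) (elim (0, 0)
    (glueRel P t)))))) (1, a) (1, b)

/-- The cell of maximal height in each of the two windows is the one chosen by `t`. -/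
def WindowMax (t : Fin 4 × Fin 4) (x y : Fin 3 → ℝ) : Prop :=
  ∀ w q, q ≠ ![t.1, t.2] w → (![x, y] (cell w q).1 (cell w q).2 : ℝ) <
    ![x, y] (cell w (![t.1, t.2] w)).1 (cell w (![t.1, t.2] w)).2

theorem satOn_glueRel_iff {P : Fin 3 → Fin 3 → Bool} {t : Fin 4 × Fin 4}
    {g : Fin 2 × Fin 3 → ℝ} :
    SatOn Set.univ (glueRel P t) g ↔ SatOn Set.univ P (fun a => g (0, a)) ∧
      WindowMax t (fun a => g (0, a)) (fun a => g (1, a)) := by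
  have key : ∀ a : Fin 2 × Fin 3,
      (![fun a => g (0, a), fun a => g (1, a)] : Fin 2 → Fin 3 → ℝ) a.1 a.2 = g a := by
    rintro ⟨i, j⟩
    fin_cases i <;> rfl
  simp only [WindowMax, key]
  constructor
  · intro h
    refine ⟨fun a _ b _ hab => h _ trivial _ trivial (by simp [glueRel, hab]), fun w q hq => ?_⟩
    refine h _ trivial _ trivial ?_
    simp only [glueRel, windowRel, Bool.or_eq_true, decide_eq_true_eq]
    exact Or.inr ⟨w, q, hq, rfl, rfl⟩
  · rintro ⟨h1, h2⟩ ⟨i, a⟩ - ⟨j, b⟩ - hab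
    simp only [glueRel, windowRel, Bool.or_eq_true, Bool.and_eq_true, beq_iff_eq,
      decide_eq_true_eq] at hab
    rcases hab with ⟨⟨rfl, rfl⟩, hab⟩ | ⟨w, q, hq, hc, hd⟩
    · exact h1 a trivial b trivial hab
    · rw [← hc, ← hd]
      exact h2 w q hq

/-- Eliminating the three left cells is the projection. The eliminations at right cells keep the
solutions and only close the relation, so that equivalent systems become equal. -/
theorem satOn_step_iff {P : Fin 3 → Fin 3 → Bool} {t : Fin 4 × Fin 4} {y : Fin 3 → ℝ} :
    SatOn Set.univ (step P t) y ↔ ∃ x, SatOn Set.univ P x ∧ WindowMax t x y := by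
  set U : Set (Fin 2 × Fin 3) := {a | a.1 = 1} with hU
  set f : Fin 2 × Fin 3 → ℝ := fun a => y a.2 with hf
  have hU0 : ∀ a, ((0, a) : Fin 2 × Fin 3) ∉ U := by simp [hU]
  have hU1 : ∀ a, ((1, a) : Fin 2 × Fin 3) ∈ U := by simp [hU]
  have hne : U.Nonempty := ⟨_, hU1 0⟩
  have huniv : (Set.univ : Set (Fin 2 × Fin 3)) =
      insert (0, 0) (insert (0, 1) (insert (0, 2) U)) := by
    ext ⟨i, j⟩
    fin_cases i <;> fin_cases j <;> simp [hU]
  have h1 : SatOn Set.univ (step P t) y ↔ SatOn U (elim (1, 2) (elim (1, 1) (elim (1, 0)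
      (elim (0, 2) (elim (0, 1) (elim (0, 0) (glueRel P t))))))) f := by
    constructor
    · rintro h ⟨i, a⟩ (rfl : i = 1) ⟨j, b⟩ (rfl : j = 1) hab
      exact h a trivial b trivial hab
    · intro h a _ b _ hab
      exact h _ (hU1 a) _ (hU1 b) hab
  have h2 : ∀ R, SatOn U R f ↔ ∃ g, Set.EqOn g f U ∧ SatOn U R g := by
    intro R
    refine ⟨fun h => ⟨f, fun _ _ => rfl, h⟩, ?_⟩
    rintro ⟨g, hg, h⟩ a ha b hb hab
    rw [← hg ha, ← hg hb]
    exact h a ha b hb hab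
  rw [h1, satOn_elim_iff (hU1 2), satOn_elim_iff (hU1 1), satOn_elim_iff (hU1 0), h2,
    ← exists_satOn_insert_iff (hU0 2) subset_rfl hne,
    ← exists_satOn_insert_iff (by simp [hU]) (Set.subset_insert _ _) (Set.insert_nonempty _ _),
    ← exists_satOn_insert_iff (by simp [hU])
      ((Set.subset_insert _ _).trans (Set.subset_insert _ _)) (Set.insert_nonempty _ _), ← huniv]
  constructor
  · rintro ⟨g, hg, h⟩
    obtain ⟨ha, hb⟩ := satOn_glueRel_iff.1 h
    refine ⟨_, ha, ?_⟩
    have : (fun a => g (1, a)) = y := funext fun a => hg (hU1 a)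
    rwa [this] at hb
  · rintro ⟨x, hx, h⟩
    refine ⟨fun a => ![x, y] a.1 a.2, ?_, satOn_glueRel_iff.2 ⟨hx, h⟩⟩
    rintro ⟨i, a⟩ (rfl : i = 1)
    rfl

/-! ### Counting feasible choices by transfer -/

/-- The choices `σ` are the window maxima for some heights `c` of the columns `0, …, k` such that
column `0` satisfies `P`. -/
def Feasible (k : ℕ) (P : Fin 3 → Fin 3 → Bool) (σ : Fin k → Fin 4 × Fin 4) : Prop :=
  ∃ c : ℕ → Fin 3 → ℝ, SatOn Set.univ P (c 0) ∧ ∀ j : Fin k, WindowMax (σ j) (c j) (c (j + 1))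

theorem feasible_cons_iff {k : ℕ} {P : Fin 3 → Fin 3 → Bool} {t : Fin 4 × Fin 4}
    {σ : Fin k → Fin 4 × Fin 4} :
    Feasible (k + 1) P (Fin.cons t σ : Fin (k + 1) → Fin 4 × Fin 4) ↔
      Feasible k (step P t) σ := by
  constructor
  · rintro ⟨c, h0, h⟩
    refine ⟨fun j => c (j + 1), satOn_step_iff.2 ⟨c 0, h0, h 0⟩, fun j => ?_⟩
    simpa using h j.succ
  · rintro ⟨c, h0, h⟩
    obtain ⟨x, hx, hxy⟩ := satOn_step_iff.1 h0
    refine ⟨fun j => Nat.casesOn j x c, hx, fun j => ?_⟩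
    refine Fin.cases ?_ (fun j => ?_) j
    · simpa using hxy
    · simpa using h j

open Classical in
/-- The number of feasible sequences of choices. -/
noncomputable def count (k : ℕ) (P : Fin 3 → Fin 3 → Bool) : ℕ :=
  ∑ σ : Fin k → Fin 4 × Fin 4, if Feasible k P σ then 1 else 0

theorem count_succ (k : ℕ) (P : Fin 3 → Fin 3 → Bool) :
    count (k + 1) P = ∑ t, ∑ b, count k (step P (t, b)) := by
  classical
  unfold count
  rw [← (Fin.consEquiv fun _ => Fin 4 × Fin 4).sum_comp, Fintype.sum_prod_type,
    Fintype.sum_prod_type]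
  refine Finset.sum_congr rfl fun t _ => Finset.sum_congr rfl fun b _ =>
    Finset.sum_congr rfl fun σ _ => ?_
  exact if_congr feasible_cons_iff rfl rfl

theorem count_zero {P : Fin 3 → Fin 3 → Bool} (x : Fin 3 → ℝ) (hx : SatOn Set.univ P x) :
    count 0 P = 1 := by
  have : ∀ σ, Feasible 0 P σ := fun σ => ⟨fun _ => x, hx, fun j => j.elim0⟩
  simp [count, this]

/-! ### The twelve states and the recurrence -/

/-- The relations on a column reached from the empty one by `step`; number `3` is the
unsatisfiable one. -/
def state (s : Fin 12) (a b : Fin 3) : Bool :=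
  decide ((a, b) ∈ (![[], [(2, 1)], [(1, 2)], [(0, 0), (0, 1), (0, 2), (1, 0), (1, 1), (1, 2),
    (2, 0), (2, 1), (2, 2)], [(0, 2), (1, 2)], [(1, 0), (2, 0)], [(1, 0)],
    [(1, 0), (2, 0), (2, 1)], [(1, 0), (1, 2)], [(0, 1)], [(0, 1), (2, 1)],
    [(0, 1), (0, 2), (1, 2)]] : Fin 12 → List (Fin 3 × Fin 3)) s)

/-- The transitions between the relations `state`. -/
def next : Fin 12 → Fin 4 → Fin 4 → Fin 12 :=
  ![![![0, 0, 1, 2], ![0, 0, 3, 4], ![5, 6, 7, 8], ![3, 9, 10, 11]],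
    ![![0, 3, 1, 2], ![0, 3, 3, 4], ![5, 3, 7, 8], ![3, 3, 10, 11]],
    ![![3, 0, 1, 2], ![3, 0, 3, 4], ![3, 6, 7, 8], ![3, 9, 10, 11]],
    ![![3, 3, 3, 3], ![3, 3, 3, 3], ![3, 3, 3, 3], ![3, 3, 3, 3]],
    ![![3, 0, 3, 4], ![3, 0, 3, 4], ![3, 6, 7, 8], ![3, 9, 10, 11]],
    ![![0, 0, 1, 2], ![3, 3, 3, 3], ![5, 5, 7, 8], ![3, 3, 10, 11]],
    ![![0, 0, 1, 2], ![3, 3, 3, 3], ![5, 6, 7, 8], ![3, 9, 10, 11]],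
    ![![0, 3, 1, 2], ![3, 3, 3, 3], ![5, 3, 7, 8], ![3, 3, 10, 11]],
    ![![3, 0, 1, 2], ![3, 3, 3, 3], ![3, 6, 7, 8], ![3, 9, 10, 11]],
    ![![3, 3, 3, 3], ![0, 0, 3, 4], ![5, 6, 7, 8], ![3, 9, 10, 11]],
    ![![3, 3, 3, 3], ![0, 3, 3, 4], ![5, 3, 7, 8], ![3, 3, 10, 11]],
    ![![3, 3, 3, 3], ![3, 0, 3, 4], ![3, 6, 7, 8], ![3, 9, 10, 11]]]

theorem step_state (s : Fin 12) (t b : Fin 4) : step (state s) (t, b) = state (next s t b) := by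
  have h : ∀ (s : Fin 12) (t b : Fin 4) (x y : Fin 3),
      step (state s) (t, b) x y = state (next s t b) x y := by decide +kernel
  exact funext fun x => funext fun y => h s t b x y

theorem count_state_succ (k : ℕ) (s : Fin 12) :
    count (k + 1) (state s) = ∑ t, ∑ b, count k (state (next s t b)) := by
  simp only [count_succ, step_state]

theorem count_state_three (k : ℕ) : count k (state 3) = 0 := by
  simp only [count, Finset.sum_eq_zero_iff, ite_eq_right_iff]
  rintro σ - ⟨c, h, -⟩
  exact absurd (h 0 trivial 0 trivial (by decide)) (lt_irrefl _)

/-- Column heights that satisfy the relation `state s`. -/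
def heights : Fin 12 → Fin 3 → ℕ :=
  ![![0, 0, 0], ![0, 1, 0], ![0, 0, 1], ![0, 0, 0], ![0, 0, 1], ![1, 0, 0], ![1, 0, 0],
    ![2, 1, 0], ![1, 0, 1], ![0, 1, 0], ![0, 1, 0], ![0, 1, 2]]

theorem count_state_zero (s : Fin 12) (hs : s ≠ 3) : count 0 (state s) = 1 := by
  have h : ∀ s : Fin 12, s ≠ 3 → ∀ a b, state s a b = true → heights s a < heights s b := by
    decide +kernel
  exact count_zero (fun a => heights s a) fun a _ b _ hab => Nat.cast_lt.2 (h s hs a b hab)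

/-- Seven relations cut the eleven satisfiable states to the four unknowns 0, 1, 2, 7. The pairs
1–9, 4–5, 2–6, 7–11 are swapped by reversing the rows; the system of relations as a whole is
preserved by the transitions, hence the joint induction. -/
theorem count_state_relations (k : ℕ) :
    count k (state 4) = count k (state 1) ∧ count k (state 5) = count k (state 1) ∧
    count k (state 9) = count k (state 1) ∧ count k (state 6) = count k (state 2) ∧
    count k (state 11) = count k (state 7) ∧
    count k (state 8) + count k (state 1) = count k (state 2) + count k (state 7) ∧
    count k (state 10) + count k (state 2) = count k (state 7) + count k (state 1) := by
  induction k with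
  | zero => simp [count_state_zero]
  | succ k ih =>
    simp only [count_state_succ, Fin.sum_univ_four]
    simp [next, count_state_three]
    omega

theorem count_state_system (k : ℕ) :
    (count (k + 1) (state 0) : ℤ) = 4 * count k (state 0) + 4 * count k (state 1) +
      2 * count k (state 2) + 4 * count k (state 7) ∧
    (count (k + 1) (state 1) : ℤ) = 2 * count k (state 0) + 3 * count k (state 1) +
      count k (state 2) + 4 * count k (state 7) ∧
    (count (k + 1) (state 2) : ℤ) = 2 * count k (state 0) + 3 * count k (state 1) +
      2 * count k (state 2) + 4 * count k (state 7) ∧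
    (count (k + 1) (state 7) : ℤ) = count k (state 0) + 2 * count k (state 1) +
      count k (state 2) + 4 * count k (state 7) := by
  have h := count_state_relations k
  simp only [count_state_succ, Fin.sum_univ_four]
  simp [next, count_state_three]
  omega

theorem count_recurrence (k : ℕ) :
    (count (k + 4) (state 0) : ℤ) = 13 * count (k + 3) (state 0) - 31 * count (k + 2) (state 0) +
      20 * count (k + 1) (state 0) - 4 * count k (state 0) := by
  obtain ⟨a0, b0, c0, d0⟩ := count_state_system k
  obtain ⟨a1, b1, c1, d1⟩ := count_state_system (k + 1)
  obtain ⟨a2, b2, c2, d2⟩ := count_state_system (k + 2)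
  obtain ⟨a3, b3, c3, d3⟩ := count_state_system (k + 3)
  simp only [add_assoc, Nat.reduceAdd] at *
  linarith

theorem count_values : count 0 (state 0) = 1 ∧ count 1 (state 0) = 14 ∧
    count 2 (state 0) = 150 ∧ count 3 (state 0) = 1536 ∧ count 4 (state 0) = 15594 := by
  obtain ⟨a0, b0, c0, d0⟩ := count_state_system 0
  obtain ⟨a1, b1, c1, d1⟩ := count_state_system 1
  obtain ⟨a2, b2, c2, d2⟩ := count_state_system 2
  obtain ⟨a3, b3, c3, d3⟩ := count_state_system 3
  have h0 := count_state_zero 0 (by decide)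
  have h1 := count_state_zero 1 (by decide)
  have h2 := count_state_zero 2 (by decide)
  have h7 := count_state_zero 7 (by decide)
  refine ⟨h0, ?_⟩
  norm_num only [h0, h1, h2, h7] at a0 b0 c0 d0
  norm_num only [a0, b0, c0, d0] at a1 b1 c1 d1
  norm_num only [a1, b1, c1, d1] at a2 b2 c2 d2
  norm_num only [a2, b2, c2, d2] at a3
  omega

/-! ### From `Q n` to feasible choices -/

/-- The vertices of the window simplices; the window `(j, w)` has its upper left corner in row `w`
and column `j`. -/
noncomputable def vertex (n : ℕ) (m : Fin (n - 1) × Fin 2) (q : Fin 4) : Fin 3 × Fin n → ℝ :=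
  e n (cell m.2 q).2 (m.1 + (cell m.2 q).1)

theorem range_vertex (n : ℕ) (m : Fin (n - 1) × Fin 2) :
    convexHull ℝ (Set.range (vertex n m)) = simplex n m.2 m.1 := by
  obtain ⟨j, w⟩ := m
  unfold simplex
  congr 1
  ext x
  fin_cases w <;>
  · simp only [Set.mem_range, Fin.exists_fin_succ, vertex, cell, Set.mem_insert_iff,
      Set.mem_singleton_iff]
    simp
    grind

theorem Q_eq_convexHull (n : ℕ) :
    Q n = convexHull ℝ (Set.range fun σ : Fin (n - 1) × Fin 2 → Fin 4 =>
      ∑ m, vertex n m (σ m)) := by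
  have h : (Set.range fun σ : Fin (n - 1) × Fin 2 → Fin 4 => ∑ m, vertex n m (σ m)) =
      ∑ m, Set.range (vertex n m) := by
    ext x
    rw [Set.mem_fintype_sum]
    constructor
    · rintro ⟨σ, rfl⟩
      exact ⟨fun m => vertex n m (σ m), fun m => ⟨σ m, rfl⟩, rfl⟩
    · rintro ⟨g, hg, rfl⟩
      choose σ hσ using hg
      exact ⟨σ, Finset.sum_congr rfl fun m _ => hσ m⟩
  rw [h, convexHull_sum]
  simp only [range_vertex, Q, Fintype.sum_prod_type_right, Finset.sum_range]

theorem e_injective {n i j i' j' : ℕ} (hi : i < 3) (hj : j < n) (h : e n i j = e n i' j') :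
    i = i' ∧ j = j' := by
  have := congrFun h (⟨i, hi⟩, ⟨j, hj⟩)
  by_contra hne
  simp [e, hne] at this

theorem cell_injective (w : Fin 2) : Function.Injective (cell w) := by
  revert w
  decide

theorem vertex_injective (n : ℕ) (m : Fin (n - 1) × Fin 2) :
    Function.Injective (vertex n m) := by
  intro q q' h
  obtain ⟨h1, h2⟩ := e_injective (by omega) (by omega) h
  refine cell_injective m.2 (Prod.ext (Fin.ext ?_) (Fin.ext h1))
  omega

/-- A choice for each window, as a choice for each pair of adjacent columns. -/
def choiceEquiv (k : ℕ) : (Fin k × Fin 2 → Fin 4) ≃ (Fin k → Fin 4 × Fin 4) :=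
  (Equiv.curry _ _ _).trans (Equiv.arrowCongr (Equiv.refl _) (finTwoArrowEquiv (Fin 4)))

theorem choiceEquiv_apply (k : ℕ) (σ : Fin k × Fin 2 → Fin 4) (j : Fin k) :
    choiceEquiv k σ j = (σ (j, 0), σ (j, 1)) := rfl

theorem exists_linear_iff_feasible (n : ℕ) (σ : Fin (n - 1) × Fin 2 → Fin 4) :
    (∃ l : (Fin 3 × Fin n → ℝ) →L[ℝ] ℝ,
      ∀ m q, q ≠ σ m → l (vertex n m q) < l (vertex n m (σ m))) ↔
    Feasible (n - 1) (state 0) (choiceEquiv (n - 1) σ) := by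
  have hcol : ∀ (c : ℕ → Fin 3 → ℝ) (j : ℕ) (a : Fin 2 × Fin 3),
      (![c j, c (j + 1)] : Fin 2 → Fin 3 → ℝ) a.1 a.2 = c (j + a.1) a.2 := by
    rintro c j ⟨i, a⟩
    fin_cases i <;> rfl
  have hσ : ∀ j w, (![σ (j, 0), σ (j, 1)] : Fin 2 → Fin 4) w = σ (j, w) := by
    intro j w
    fin_cases w <;> rfl
  have h0 : ∀ x, SatOn Set.univ (state 0) x := by
    intro x a _ b _ hab
    simp [state] at hab
  simp only [Feasible, h0, true_and, WindowMax, hcol, choiceEquiv_apply, hσ]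
  constructor
  · rintro ⟨l, h⟩
    -- Columns `j ≥ n` get height 0, as `e n i j = 0` there; no window meets them.
    exact ⟨fun j i => l (e n i j), fun j w q hq => h (j, w) q hq⟩
  · rintro ⟨c, h⟩
    refine ⟨∑ p : Fin 3 × Fin n, c p.2 p.1 • ContinuousLinearMap.proj p, ?_⟩
    have hl : ∀ m q, (∑ p : Fin 3 × Fin n, c p.2 p.1 •
        (ContinuousLinearMap.proj p : (Fin 3 × Fin n → ℝ) →L[ℝ] ℝ)) (vertex n m q) =
        c (m.1 + (cell m.2 q).1) (cell m.2 q).2 := by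
      intro m q
      have hj : (m.1 : ℕ) + (cell m.2 q).1 < n := by omega
      rw [_root_.sum_apply,
        Finset.sum_eq_single ((cell m.2 q).2, (⟨_, hj⟩ : Fin n))]
      · simp [vertex, e]
      · rintro ⟨i, j⟩ - hne
        have : ¬ ((i : ℕ) = (cell m.2 q).2 ∧ (j : ℕ) = m.1 + (cell m.2 q).1) := fun h' =>
          hne (Prod.ext (Fin.ext h'.1) (Fin.ext h'.2))
        simp [vertex, e, this]
      · simp
    rintro ⟨j, w⟩ q hq
    rw [hl, hl]
    exact h j w q hq

theorem V_eq_count (n : ℕ) : V n = count (n - 1) (state 0) := by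
  classical
  unfold V
  rw [Q_eq_convexHull, ncard_extremePoints_convexHull_range_sum _ (vertex_injective n)]
  simp only [exists_linear_iff_feasible]
  rw [count, ← Finset.card_filter, ← Set.ncard_coe_finset,
    ← Set.ncard_image_of_injective _ (choiceEquiv (n - 1)).injective]
  congr 1
  ext τ
  simp only [Set.mem_image, Set.mem_ofPred_eq, Finset.coe_filter, Finset.mem_univ, true_and]
  constructor
  · rintro ⟨σ, h, rfl⟩
    exact h
  · intro h
    exact ⟨(choiceEquiv (n - 1)).symm τ, by simpa using h, by simp⟩

end MaxPool

/-! ### The generating function -/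

open PowerSeries in
theorem theorem5p2 :
    ((X : ℚ⟦X⟧) + PowerSeries.mk (fun n : ℕ => if 2 ≤ n then (MaxPool.V n : ℚ) else 0)
        = (X + X ^ 2 - X ^ 3) * (1 - 13 * X + 31 * X ^ 2 - 20 * X ^ 3 + 4 * X ^ 4)⁻¹) ∧
    (∀ n : ℕ, 2 ≤ n →
      (MaxPool.V (n + 4) : ℤ)
        = 13 * (MaxPool.V (n + 3) : ℤ) - 31 * (MaxPool.V (n + 2) : ℤ)
          + 20 * (MaxPool.V (n + 1) : ℤ) - 4 * (MaxPool.V n : ℤ)) ∧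
    MaxPool.V 2 = 14 ∧ MaxPool.V 3 = 150 ∧ MaxPool.V 4 = 1536 ∧ MaxPool.V 5 = 15594 := by
  obtain ⟨v1, v2, v3, v4, v5⟩ := MaxPool.count_values
  -- The recurrence already starts at `n = 1`, where the empty sum gives `V 1 = 1`; the extra term
  -- `X` of the series is thus its `n = 1` term.
  have hrec : ∀ n : ℕ, 1 ≤ n →
      (MaxPool.V (n + 4) : ℤ)
        = 13 * (MaxPool.V (n + 3) : ℤ) - 31 * (MaxPool.V (n + 2) : ℤ)
          + 20 * (MaxPool.V (n + 1) : ℤ) - 4 * (MaxPool.V n : ℤ) := by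
    intro n hn
    obtain ⟨k, rfl⟩ := Nat.exists_eq_add_of_le' hn
    simp only [MaxPool.V_eq_count]
    exact MaxPool.count_recurrence k
  have h1 : MaxPool.V 1 = 1 := (MaxPool.V_eq_count 1).trans v1
  have h2 : MaxPool.V 2 = 14 := (MaxPool.V_eq_count 2).trans v2
  have h3 : MaxPool.V 3 = 150 := (MaxPool.V_eq_count 3).trans v3
  have h4 : MaxPool.V 4 = 1536 := (MaxPool.V_eq_count 4).trans v4
  have h5 : MaxPool.V 5 = 15594 := (MaxPool.V_eq_count 5).trans v5
  refine ⟨?_, fun n hn => hrec n (by omega), h2, h3, h4, h5⟩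
  have hmk : (X : ℚ⟦X⟧) + PowerSeries.mk (fun n : ℕ => if 2 ≤ n then (MaxPool.V n : ℚ) else 0) =
      PowerSeries.mk (fun n : ℕ => if 1 ≤ n then (MaxPool.V n : ℚ) else 0) := by
    ext n
    rw [map_add, coeff_mk, coeff_mk, coeff_X]
    obtain rfl | rfl | hn : n = 0 ∨ n = 1 ∨ 2 ≤ n := by omega
    · simp
    · simp [h1]
    · simp [hn, show n ≠ 1 by omega, show 1 ≤ n by omega]
  have hC : (1 - 13 * X + 31 * X ^ 2 - 20 * X ^ 3 + 4 * X ^ 4 : ℚ⟦X⟧) =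
      1 - C 13 * X + C 31 * X ^ 2 - C 20 * X ^ 3 + C 4 * X ^ 4 := by
    simp only [map_ofNat]
  rw [PowerSeries.eq_mul_inv_iff_mul_eq (by simp [hC]), hmk, hC]
  set F : ℚ⟦X⟧ := PowerSeries.mk (fun n : ℕ => if 1 ≤ n then (MaxPool.V n : ℚ) else 0) with hF
  have hexp : F * (1 - C 13 * X + C 31 * X ^ 2 - C 20 * X ^ 3 + C 4 * X ^ 4) =
      F - C 13 * (F * X) + C 31 * (F * X ^ 2) - C 20 * (F * X ^ 3) + C 4 * (F * X ^ 4) := by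
    ring
  rw [hexp]
  ext n
  simp only [map_add, map_sub, coeff_C_mul, coeff_mul_X_pow', coeff_X_pow, coeff_X]
  rw [show F * X = F * X ^ 1 by rw [pow_one], coeff_mul_X_pow']
  simp only [hF, coeff_mk]
  -- The case `n = 4` is separate because the series has coefficient 0 at index 0, not `V 0`.
  obtain rfl | rfl | rfl | rfl | rfl | hn : n = 0 ∨ n = 1 ∨ n = 2 ∨ n = 3 ∨ n = 4 ∨ 5 ≤ n := by
    omega
  · simp
  · simp [h1]
  · norm_num [h1, h2]
  · norm_num [h1, h2, h3]
  · norm_num [h1, h2, h3, h4]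
  · obtain ⟨k, rfl⟩ := Nat.exists_eq_add_of_le' hn
    have := hrec (k + 1) (by omega)
    rw [show k + 1 + 4 = k + 5 by ring, show k + 1 + 3 = k + 4 by ring,
      show k + 1 + 2 = k + 3 by ring, show k + 1 + 1 = k + 2 by ring] at this
    have hq := congrArg (Int.cast : ℤ → ℚ) this
    push_cast at hq
    simp [show k + 5 - 1 = k + 4 by omega, show k + 5 - 2 = k + 3 by omega,
      show k + 5 - 3 = k + 2 by omega, show k + 5 - 4 = k + 1 by omega, hq]
    ring
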